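/- For a simple graph $G$ with finite vertex set $V$, let $S(G)$ be the set of real symmetric matrices $A=(a_{ij})_{i,j\in V}$ such that, for $i\neq j$, $a_{ij}\neq 0$ if and only if $\{i,j\}$ is an edge of $G$ (the diagonal entries are free). Let $q(A)$ be the number of distinct eigenvalues of $A$, and let $q(G)=\min\{q(A): A\in S(G)\}$. For integers $m,n\geq 0$, let $S_{m,n}$ be the graph on $m+n+4$ vertices consisting of a $4$-cycle with vertices $v_1,u_1,v_2,u_2$ and edges $v_1u_1$, $u_1v_2$, $v_2u_2$, $u_2v_1$, together with a path $P_{m+1}$ on $m+1$ vertices starting at $v_1$ and a path $P_{n+1}$ on $n+1$ vertices starting at $v_2$, where the two paths are disjoint and meet the $4$-cycle only in $v_1$ and $v_2$, respectively. If $m$ and $n$ have the same parity, then $$q(S_{m,n})=\max\{m,n\}+2.$$ -/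

import Mathlib

namespace DistinctEigenvalues

/-- The set `S(G)` of real symmetric matrices indexed by the vertices of `G` whose off-diagonal
entries are nonzero exactly at the edges of `G`; the diagonal entries are free. -/
def symmMatrices {V : Type*} (G : SimpleGraph V) : Set (Matrix V V ℝ) :=
  {A | A.IsSymm ∧ ∀ i j, i ≠ j → (A i j ≠ 0 ↔ G.Adj i j)}

/-- The number `q(A)` of distinct (real) eigenvalues of a real square matrix. It is used for
symmetric matrices only, all of whose eigenvalues are real. -/
noncomputable def qMatrix {V : Type*} [Fintype V] [DecidableEq V] (A : Matrix V V ℝ) : ℕ :=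
  Set.ncard {μ : ℝ | Module.End.HasEigenvalue (Matrix.toLin' A) μ}

/-- The number `q(G)`: the minimum of `q(A)` over all `A ∈ S(G)`. -/
noncomputable def qGraph {V : Type*} [Fintype V] [DecidableEq V] (G : SimpleGraph V) : ℕ :=
  sInf (qMatrix '' symmMatrices G)

/-- `S(G)` is never empty. -/
theorem symmMatrices_nonempty {V : Type*} (G : SimpleGraph V) : (symmMatrices G).Nonempty := by
  classical
  refine ⟨G.adjMatrix ℝ, G.isSymm_adjMatrix, fun i j _ => ?_⟩
  simp [SimpleGraph.adjMatrix_apply]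

/-- The infimum defining `q(G)` is a minimum. -/
theorem qGraph_isLeast {V : Type*} [Fintype V] [DecidableEq V] (G : SimpleGraph V) :
    IsLeast (qMatrix '' symmMatrices G) (qGraph G) :=
  ⟨Nat.sInf_mem ((symmMatrices_nonempty G).image _), fun _ h => Nat.sInf_le h⟩

/-- The vertices of `S_{m,n}`: the `m + 1` vertices of the first path, the `n + 1` vertices of the
second path, and the two remaining vertices of the 4-cycle. -/
abbrev SVertex (m n : ℕ) : Type := Fin (m + 1) ⊕ (Fin (n + 1) ⊕ Fin 2)

/-- Adjacency in `S_{m,n}`. The vertices `inl 0` and `inr (inl 0)` are the starting points of the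
two paths; they are the two opposite vertices `v₁` and `v₂` of the 4-cycle whose other two
vertices are `inr (inr 0)` and `inr (inr 1)`. -/
def SAdj (m n : ℕ) : SVertex m n → SVertex m n → Prop
  | .inl i, .inl j => (SimpleGraph.pathGraph (m + 1)).Adj i j
  | .inl _, .inr (.inl _) => False
  | .inl i, .inr (.inr _) => i = 0
  | .inr (.inl _), .inl _ => False
  | .inr (.inl i), .inr (.inl j) => (SimpleGraph.pathGraph (n + 1)).Adj i j
  | .inr (.inl i), .inr (.inr _) => i = 0
  | .inr (.inr _), .inl j => j = 0
  | .inr (.inr _), .inr (.inl j) => j = 0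
  | .inr (.inr _), .inr (.inr _) => False

/-- The graph `S_{m,n}`: a 4-cycle together with disjoint paths with `m + 1` and `n + 1` vertices
starting at two opposite vertices of the cycle and meeting the cycle nowhere else. -/
def SGraph (m n : ℕ) : SimpleGraph (SVertex m n) where
  Adj := SAdj m n
  symm := ⟨by
    rintro (i | i | i) (j | j | j) h <;> first | exact h.symm | exact h⟩
  loopless := ⟨by
    rintro (i | i | i) h
    · exact SimpleGraph.irrefl _ h
    · exact SimpleGraph.irrefl _ h
    · exact h⟩

end DistinctEigenvalues

/-!
Lower bound. Walk from the far end of the path attached at `v₁` through that path to `u₁`. Each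
vertex before `u₁` is the only one at its distance from the start, so for `A ∈ S(G)` and `e` the
indicator of the start, `A ^ k *ᵥ e` vanishes beyond distance `k` but not at the `k`-th vertex of
the walk, for every `k ≤ m + 1`. Hence no monic polynomial of degree at most `m + 1` kills `A`.
Since `A` is diagonalizable, `∏ (X - μ)` over its distinct eigenvalues does kill it, so there are
at least `m + 2` of them; by symmetry, there are at least `n + 2` (`add_one_le_qMatrix`).

Upper bound. If the diagonal entries at `u₁`, `u₂` agree and the rows of `v₁`, `v₂` restricted to
`{u₁, u₂}` are orthogonal, a rotation of the `u`-coordinates makes `A` a direct sum of two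
tridiagonal matrices of orders `m + 2` and `n + 2`. Both are taken to be Sylvester–Kac matrices:
the one of order `N + 1` has spectrum `N, N - 2, …, -N` (`kacMatrix_eigenvalue`), so when `m` and
`n` have the same parity the smaller spectrum is contained in the larger one, which has
`max m n + 2` elements.
-/

open Polynomial Matrix

namespace DistinctEigenvalues

/-! ### Lower bound from a level function -/

/-- The product of `X - μ` over the distinct eigenvalues of a real symmetric matrix kills it,
because an orthonormal basis of eigenvectors exists. -/
theorem exists_monic_aeval_eq_zero {V : Type*} [Fintype V] [DecidableEq V]
    {A : Matrix V V ℝ} (hA : A.IsSymm) :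
    ∃ f : ℝ[X], f.Monic ∧ f.natDegree = qMatrix A ∧ aeval (Matrix.toLin' A) f = 0 := by
  have hH : A.IsHermitian := by
    rw [Matrix.IsHermitian, Matrix.conjTranspose_eq_transpose_of_trivial]; exact hA
  have hfin : {μ : ℝ | Module.End.HasEigenvalue (Matrix.toLin' A) μ}.Finite :=
    Module.End.finite_hasEigenvalue _
  refine ⟨∏ μ ∈ hfin.toFinset, (X - C μ), monic_prod_X_sub_C _ _, ?_, ?_⟩
  · rw [natDegree_finsetProd_X_sub_C_eq_card, qMatrix, Set.ncard_eq_toFinset_card _ hfin]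
  · let b := hH.eigenvectorBasis.toBasis.map (WithLp.linearEquiv 2 ℝ (V → ℝ))
    refine b.ext fun i => ?_
    have hv : Module.End.HasEigenvector (Matrix.toLin' A) (hH.eigenvalues i) (b i) := by
      refine ⟨Module.End.mem_eigenspace_iff.2 ?_, b.ne_zero i⟩
      simpa [b] using hH.mulVec_eigenvectorBasis i
    rw [Module.End.aeval_apply_of_hasEigenvector hv, eval_prod,
      Finset.prod_eq_zero (i := hH.eigenvalues i)]
    · simp
    · simpa using Module.End.hasEigenvalue_of_hasEigenvector hv
    · simp

section Level

variable {V : Type*} [Fintype V] [DecidableEq V] {G : SimpleGraph V} {A : Matrix V V ℝ}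
  {l : V → ℕ} {p : ℕ → V} {d : ℕ}

theorem pow_apply_eq_zero (hA : A ∈ symmMatrices G) (hl : ∀ u v, G.Adj u v → l v ≤ l u + 1)
    {s : V} (hs : l s = 0) (k : ℕ) (v : V) (hv : k < l v) :
    ((Matrix.toLin' A) ^ k) (Pi.single s 1) v = 0 := by
  induction k generalizing v with
  | zero =>
    have : v ≠ s := by rintro rfl; omega
    simp [this]
  | succ k ih =>
    rw [pow_succ', Module.End.mul_apply, Matrix.toLin'_apply, Matrix.mulVec, dotProduct]
    refine Finset.sum_eq_zero fun u _ => ?_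
    by_cases huv : v = u
    · subst huv; rw [ih v (by omega), mul_zero]
    by_cases h : G.Adj v u
    · rw [ih u (by have := hl u v h.symm; omega), mul_zero]
    · rw [not_not.1 (mt (hA.2 v u huv).1 h), zero_mul]

/-- Along the walk `p`, whose vertices before the `d`-th are alone on their levels, only one term
of the matrix product survives at each step. -/
theorem pow_apply_ne_zero (hA : A ∈ symmMatrices G) (hl : ∀ u v, G.Adj u v → l v ≤ l u + 1)
    (hp : ∀ k ≤ d, l (p k) = k) (hadj : ∀ k < d, G.Adj (p k) (p (k + 1)))
    (huniq : ∀ k < d, ∀ v, l v = k → v = p k) (k : ℕ) (hk : k ≤ d) :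
    ((Matrix.toLin' A) ^ k) (Pi.single (p 0) 1) (p k) ≠ 0 := by
  induction k with
  | zero => simp
  | succ k ih =>
    rw [pow_succ', Module.End.mul_apply, Matrix.toLin'_apply, Matrix.mulVec, dotProduct,
      Finset.sum_eq_single (p k)]
    · exact mul_ne_zero ((hA.2 _ _ (hadj k hk).ne').2 (hadj k hk).symm) (ih (by omega))
    · intro u _ hu
      by_cases hlu : k < l u
      · rw [pow_apply_eq_zero hA hl (hp 0 (by omega)) k u hlu, mul_zero]
      have hne : p (k + 1) ≠ u := by rintro rfl; exact hlu (by rw [hp _ hk]; omega)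
      have : ¬ G.Adj (p (k + 1)) u := fun h => by
        have h1 := hl u _ h.symm
        rw [hp _ hk] at h1
        exact hu (huniq k hk u (by omega))
      rw [not_not.1 (mt (hA.2 _ u hne).1 this), zero_mul]
    · simp

/-- If the vertices `p 0, …, p d` form a walk through increasing levels and each of
`p 0, …, p (d - 1)` is alone on its level, every matrix in `S(G)` has more than `d` distinct
eigenvalues. -/
theorem add_one_le_qMatrix (hA : A ∈ symmMatrices G) (hl : ∀ u v, G.Adj u v → l v ≤ l u + 1)
    (hp : ∀ k ≤ d, l (p k) = k) (hadj : ∀ k < d, G.Adj (p k) (p (k + 1)))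
    (huniq : ∀ k < d, ∀ v, l v = k → v = p k) : d + 1 ≤ qMatrix A := by
  by_contra! hlt
  obtain ⟨f, hf, hdeg, hzero⟩ := exists_monic_aeval_eq_zero hA.1
  set q := qMatrix A
  have h := congrFun (LinearMap.congr_fun hzero (Pi.single (p 0) 1)) (p q)
  rw [aeval_eq_sum_range, hdeg, Finset.sum_range_succ, ← hdeg, hf.coeff_natDegree, hdeg,
    one_smul, LinearMap.add_apply, Pi.add_apply, LinearMap.sum_apply, Finset.sum_apply,
    Finset.sum_eq_zero, zero_add] at h
  · exact pow_apply_ne_zero hA hl hp hadj huniq q (by omega) h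
  · intro k hk
    rw [Finset.mem_range] at hk
    rw [LinearMap.smul_apply, Pi.smul_apply, pow_apply_eq_zero hA hl (hp 0 (by omega)) k _
      (by rw [hp q (by omega)]; exact hk), smul_zero]

end Level

theorem left_le_qMatrix {m n : ℕ} {A : Matrix (SVertex m n) (SVertex m n) ℝ}
    (hA : A ∈ symmMatrices (SGraph m n)) : m + 2 ≤ qMatrix A := by
  refine add_one_le_qMatrix (d := m + 1) hA
    -- the levels are the distances from the end of the first path, cut off at `m + 2`
    (l := Sum.elim (fun i => m - i.val) (Sum.elim (fun _ => m + 2) (fun _ => m + 1)))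
    (p := fun k => if k ≤ m then .inl ⟨m - k, by omega⟩ else .inr (.inr 0)) ?_ ?_ ?_ ?_
  · rintro (i | i | i) (j | j | j) h <;>
      simp_all [SGraph, SAdj, SimpleGraph.pathGraph_adj] <;> omega
  · intro k hk
    by_cases h : k ≤ m
    · simp [h]; omega
    · simp [h]; omega
  · intro k hk
    have h1 : k ≤ m := by omega
    by_cases h2 : k + 1 ≤ m
    · simp [h1, h2, SGraph, SAdj, SimpleGraph.pathGraph_adj]; omega
    · have : k = m := by omega
      subst this
      simp [SGraph, SAdj]
  · rintro k hk (i | i | i) h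
    · have h1 : k ≤ m := by omega
      simp at h
      simp [h1, Fin.ext_iff]; omega
    · simp at h; omega
    · simp at h; omega

theorem right_le_qMatrix {m n : ℕ} {A : Matrix (SVertex m n) (SVertex m n) ℝ}
    (hA : A ∈ symmMatrices (SGraph m n)) : n + 2 ≤ qMatrix A := by
  refine add_one_le_qMatrix (d := n + 1) hA
    (l := Sum.elim (fun _ => n + 2) (Sum.elim (fun i => n - i.val) (fun _ => n + 1)))
    (p := fun k => if k ≤ n then .inr (.inl ⟨n - k, by omega⟩) else .inr (.inr 0)) ?_ ?_ ?_ ?_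
  · rintro (i | i | i) (j | j | j) h <;>
      simp_all [SGraph, SAdj, SimpleGraph.pathGraph_adj] <;> omega
  · intro k hk
    by_cases h : k ≤ n
    · simp [h]; omega
    · simp [h]; omega
  · intro k hk
    have h1 : k ≤ n := by omega
    by_cases h2 : k + 1 ≤ n
    · simp [h1, h2, SGraph, SAdj, SimpleGraph.pathGraph_adj]; omega
    · have : k = n := by omega
      subst this
      simp [SGraph, SAdj]
  · rintro k hk (i | i | i) h
    · simp at h; omega
    · have h1 : k ≤ n := by omega
      simp at h
      simp [h1, Fin.ext_iff]; omega
    · simp at h; omega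

/-! ### The Sylvester–Kac matrix -/

/-- The entry `√((i + 1)(N - i))` of the Sylvester–Kac matrix in positions `(i, i + 1)` and
`(i + 1, i)`. The truncated subtraction makes it `0` for `i ≥ N`. -/
noncomputable def kacCoeff (N i : ℕ) : ℝ := √(((i + 1) * (N - i) : ℕ) : ℝ)

/-- The symmetric Sylvester–Kac matrix of order `N + 1`. -/
noncomputable def kacMatrix (N : ℕ) : Matrix (Fin (N + 1)) (Fin (N + 1)) ℝ := fun i j =>
  (if j.val = i.val + 1 then kacCoeff N i else 0) + (if i.val = j.val + 1 then kacCoeff N j else 0)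

theorem kacMatrix_comm (N : ℕ) (i j : Fin (N + 1)) : kacMatrix N i j = kacMatrix N j i :=
  add_comm _ _

theorem kacMatrix_ne_zero_iff {N : ℕ} {i j : Fin (N + 1)} :
    kacMatrix N i j ≠ 0 ↔ i.val + 1 = j.val ∨ j.val + 1 = i.val := by
  have key : ∀ k, k < N → kacCoeff N k ≠ 0 := fun k hk => by
    have : 0 < (k + 1) * (N - k) := Nat.mul_pos (by omega) (by omega)
    exact (Real.sqrt_pos.2 (by exact_mod_cast this)).ne'
  unfold kacMatrix
  by_cases h1 : j.val = i.val + 1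
  · rw [if_pos h1, if_neg (by omega), add_zero]
    exact iff_of_true (key _ (by omega)) (by omega)
  by_cases h2 : i.val = j.val + 1
  · rw [if_neg h1, if_pos h2, zero_add]
    exact iff_of_true (key _ (by omega)) (by omega)
  · rw [if_neg h1, if_neg h2, add_zero]
    exact iff_of_false (by simp) (by omega)

theorem succ_mul_sqrt_choose (N i : ℕ) :
    ((i : ℝ) + 1) * √(N.choose (i + 1)) = √(N.choose i) * kacCoeff N i := by
  have h : N.choose i * ((i + 1) * (N - i)) = (i + 1) ^ 2 * N.choose (i + 1) := by
    rw [mul_left_comm, ← Nat.choose_succ_right_eq]; ring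
  rw [kacCoeff, ← Real.sqrt_mul (by positivity), ← Nat.cast_mul, h, Nat.cast_mul,
    Real.sqrt_mul (by positivity)]
  push_cast
  rw [Real.sqrt_sq (by positivity)]

theorem sub_mul_sqrt_choose {N i : ℕ} (hi : i ≤ N) :
    ((N : ℝ) - i) * √(N.choose i) = √(N.choose (i + 1)) * kacCoeff N i := by
  have h : N.choose (i + 1) * ((i + 1) * (N - i)) = (N - i) ^ 2 * N.choose i := by
    rw [← mul_assoc, Nat.choose_succ_right_eq]; ring
  rw [kacCoeff, ← Real.sqrt_mul (by positivity), ← Nat.cast_mul, h, Nat.cast_mul,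
    Real.sqrt_mul (by positivity)]
  push_cast [Nat.cast_sub hi]
  rw [Real.sqrt_sq (by have : (i : ℝ) ≤ N := by exact_mod_cast hi
                       linarith)]

/-- The operator `p ↦ (1 - X²) p' + N X p` only has eigenvalues `N - 2k`, where `k` is the order
of the eigenfunction at the root `1`: cancel `(X - 1) ^ k` and evaluate at `1`. -/
theorem exists_eq_sub_of_derivative {N : ℕ} {μ : ℝ} {p : ℝ[X]} (hp : p ≠ 0)
    (hdeg : p.natDegree ≤ N)
    (h : (1 - X ^ 2) * derivative p + C (N : ℝ) * X * p = C μ * p) :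
    ∃ k ≤ N, μ = N - 2 * k := by
  obtain ⟨r, hr, hr1⟩ := exists_eq_pow_rootMultiplicity_mul_and_not_dvd p hp 1
  set k := p.rootMultiplicity 1
  refine ⟨k, ?_, ?_⟩
  · exact (count_roots p).symm.le.trans
      ((Multiset.count_le_card _ _).trans (p.card_roots'.trans hdeg))
  · have hr1' : r.eval 1 ≠ 0 := fun h0 => hr1 (dvd_iff_isRoot.2 h0)
    have hX : (X - C (1 : ℝ)) ≠ 0 := X_sub_C_ne_zero 1
    have hd : (X - C (1 : ℝ)) * derivative p =
        (X - C 1) ^ k * (C (k : ℝ) * r + (X - C 1) * derivative r) := by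
      rw [hr, derivative_mul, derivative_X_sub_C_pow]
      rcases k with _ | k
      · simp
      · simp only [Nat.add_sub_cancel]; ring
    have h2 : (X - C (1 : ℝ)) ^ k * (-(1 + X) * (C (k : ℝ) * r + (X - C 1) * derivative r)
        + C (N : ℝ) * X * r) = (X - C (1 : ℝ)) ^ k * (C μ * r) := by
      have h3 : (1 - X ^ 2 : ℝ[X]) = -(1 + X) * (X - C 1) := by simp only [map_one]; ring
      rw [h3, mul_assoc, hd] at h
      calc _ = -(1 + X) * ((X - C (1 : ℝ)) ^ k * (C (k : ℝ) * r + (X - C 1) * derivative r))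
              + C (N : ℝ) * X * ((X - C 1) ^ k * r) := by ring
        _ = C μ * ((X - C 1) ^ k * r) := by rw [← hr]; exact h
        _ = _ := by ring
    have h4 := congrArg (eval 1) (mul_left_cancel₀ (pow_ne_zero k hX) h2)
    simp only [eval_add, eval_mul, eval_neg, eval_one, eval_X, eval_C, eval_sub, sub_self,
      zero_mul, add_zero] at h4
    have h5 : (μ - (N - 2 * k)) * r.eval 1 = 0 := by linear_combination -h4
    linarith [(mul_eq_zero.1 h5).resolve_right hr1']

/-- The eigenvalues of the Sylvester–Kac matrix of order `N + 1` are among `N, N - 2, …, -N`: in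
the basis `√(N.choose i) X ^ i` of the polynomials of degree at most `N`, the matrix represents
`p ↦ (1 - X²) p' + N X p`. -/
theorem kacMatrix_eigenvalue {N : ℕ} {μ : ℝ} {y : Fin (N + 1) → ℝ} (hy : y ≠ 0)
    (h : kacMatrix N *ᵥ y = μ • y) : ∃ k ≤ N, μ = N - 2 * k := by
  let Y : ℕ → ℝ := fun i => if hi : i < N + 1 then y ⟨i, hi⟩ else 0
  have hYy : ∀ i : Fin (N + 1), Y i = y i := fun i => dif_pos i.2
  have hY0 : ∀ i, N < i → Y i = 0 := fun i hi => dif_neg (by omega)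
  have hrow : ∀ i ≤ N, kacCoeff N i * Y (i + 1) +
      ∑ j ∈ Finset.range (N + 1), (if i = j + 1 then kacCoeff N j * Y j else 0) = μ * Y i := by
    intro i hi
    have h1 := congrFun h ⟨i, by omega⟩
    simp only [Matrix.mulVec, dotProduct, Pi.smul_apply, smul_eq_mul, kacMatrix, add_mul,
      ite_mul, zero_mul, ← hYy] at h1
    rw [Fin.sum_univ_eq_sum_range (fun j => (if j = i + 1 then kacCoeff N i * Y j else 0) +
      (if i = j + 1 then kacCoeff N j * Y j else 0)), Finset.sum_add_distrib,
      Finset.sum_ite_eq'] at h1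
    rw [← h1]
    congr 1
    split_ifs with h2
    · rfl
    · rw [hY0 _ (by simpa using h2), mul_zero]
  let p : ℝ[X] := ∑ i ∈ Finset.range (N + 1), monomial i (√(N.choose i) * Y i)
  have hc : ∀ i, p.coeff i = √(N.choose i) * Y i := by
    intro i
    simp only [p, finsetSum_coeff, coeff_monomial, Finset.sum_ite_eq']
    split_ifs with h2
    · rfl
    · rw [hY0 _ (by simpa using h2), mul_zero]
  refine exists_eq_sub_of_derivative (p := p) ?_ ?_ ?_
  · intro hp
    refine hy (funext fun i => ?_)
    have h1 := hc i
    rw [hp, coeff_zero, hYy] at h1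
    have : 0 < N.choose i := Nat.choose_pos (by omega)
    exact (mul_eq_zero.1 h1.symm).resolve_left
      (Real.sqrt_pos.2 (by exact_mod_cast this)).ne'
  · exact natDegree_le_iff_coeff_eq_zero.2 fun i hi => by rw [hc, hY0 i hi, mul_zero]
  · have hexp : (1 - X ^ 2) * derivative p + C (N : ℝ) * X * p =
        derivative p - X * (X * derivative p) + C (N : ℝ) * (X * p) := by ring
    rw [hexp]
    ext i
    rcases i with _ | i
    · have h1 := hrow 0 (by omega)
      rw [Finset.sum_eq_zero (fun j _ => if_neg (by omega))] at h1
      have h2 := succ_mul_sqrt_choose N 0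
      simp [coeff_derivative, hc] at h1 h2 ⊢
      rw [h2, h1]
    · have h3 : (X * derivative p).coeff i = i * p.coeff i := by
        rcases i with _ | i
        · simp
        · rw [coeff_X_mul, coeff_derivative]; push_cast; ring
      simp only [coeff_add, coeff_sub, coeff_X_mul, coeff_C_mul, coeff_derivative, h3, hc]
      have h2 := succ_mul_sqrt_choose N (i + 1)
      by_cases hi : i + 1 ≤ N
      · have h1 := hrow (i + 1) hi
        simp only [Nat.add_right_cancel_iff, Finset.sum_ite_eq, Finset.mem_range] at h1
        rw [if_pos (by omega)] at h1
        have h4 := sub_mul_sqrt_choose (N := N) (i := i) (by omega)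
        linear_combination Y (i + 1 + 1) * h2 + Y i * h4 + √(N.choose (i + 1)) * h1
      · rw [hY0 (i + 1) (by omega), hY0 (i + 1 + 1) (by omega)]
        rcases Nat.lt_or_ge N i with h5 | h5
        · rw [hY0 i h5]; ring
        · have : i = N := by omega
          subst this; ring

/-! ### Gluing two Sylvester–Kac matrices along the 4-cycle -/

/-- The signs `1, -1` of the two middle vertices of the cycle in the row of `v₂`; the row of `v₁`
is constant there, which makes the two rows orthogonal. -/
def sign (k : Fin 2) : ℝ := if k = 0 then 1 else -1

/-- The matrix in `S(S_{m,n})` that becomes the direct sum of the Sylvester–Kac matrices of orders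
`m + 2` and `n + 2` in the rotated coordinates `(x u₁ ± x u₂) / √2`, each of which extends one of
the two paths by a vertex in front. -/
noncomputable def gluedMatrix (m n : ℕ) : Matrix (SVertex m n) (SVertex m n) ℝ
  | .inl i, .inl j => kacMatrix (m + 1) i.succ j.succ
  | .inl _, .inr (.inl _) => 0
  | .inl i, .inr (.inr _) => kacMatrix (m + 1) i.succ 0 / √2
  | .inr (.inl _), .inl _ => 0
  | .inr (.inl i), .inr (.inl j) => kacMatrix (n + 1) i.succ j.succ
  | .inr (.inl i), .inr (.inr k) => sign k * (kacMatrix (n + 1) i.succ 0 / √2)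
  | .inr (.inr _), .inl j => kacMatrix (m + 1) 0 j.succ / √2
  | .inr (.inr k), .inr (.inl j) => sign k * (kacMatrix (n + 1) 0 j.succ / √2)
  | .inr (.inr _), .inr (.inr _) => 0

theorem sign_ne_zero (k : Fin 2) : sign k ≠ 0 := by
  unfold sign; split_ifs <;> norm_num

theorem kacMatrix_succ_zero_ne_zero_iff {N : ℕ} {i : Fin (N + 1)} :
    kacMatrix (N + 1) i.succ 0 ≠ 0 ↔ i = 0 := by
  rw [kacMatrix_ne_zero_iff, Fin.ext_iff]; simp

theorem gluedMatrix_mem (m n : ℕ) : gluedMatrix m n ∈ symmMatrices (SGraph m n) := by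
  have h2 : √(2 : ℝ) ≠ 0 := by positivity
  refine ⟨Matrix.IsSymm.ext ?_, ?_⟩
  · rintro (i | i | i) (j | j | j) <;> simp only [gluedMatrix] <;>
      first | rfl | rw [kacMatrix_comm]
  · rintro (i | i | i) (j | j | j) hij
    · simp [gluedMatrix, SGraph, SAdj, SimpleGraph.pathGraph_adj, kacMatrix_ne_zero_iff,
        -ne_eq]
    · simp [gluedMatrix, SGraph, SAdj]
    · simpa [gluedMatrix, SGraph, SAdj, h2] using kacMatrix_succ_zero_ne_zero_iff
    · simp [gluedMatrix, SGraph, SAdj]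
    · simp [gluedMatrix, SGraph, SAdj, SimpleGraph.pathGraph_adj, kacMatrix_ne_zero_iff,
        -ne_eq]
    · simpa [gluedMatrix, SGraph, SAdj, h2, sign_ne_zero] using kacMatrix_succ_zero_ne_zero_iff
    · rw [gluedMatrix, kacMatrix_comm]
      simpa [SGraph, SAdj, h2] using kacMatrix_succ_zero_ne_zero_iff
    · rw [gluedMatrix, kacMatrix_comm]
      simpa [SGraph, SAdj, h2, sign_ne_zero] using kacMatrix_succ_zero_ne_zero_iff
    · simp [gluedMatrix, SGraph, SAdj]

theorem gluedMatrix_eigenvalue {m n : ℕ} {μ : ℝ} {x : SVertex m n → ℝ} (hx : x ≠ 0)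
    (h : gluedMatrix m n *ᵥ x = μ • x) :
    (∃ k ≤ m + 1, μ = (m + 1 : ℕ) - 2 * k) ∨ (∃ k ≤ n + 1, μ = (n + 1 : ℕ) - 2 * k) := by
  have h2 : √(2 : ℝ) ≠ 0 := by positivity
  have hs : √(2 : ℝ) * √2 = 2 := Real.mul_self_sqrt (by norm_num)
  let y : Fin (m + 1 + 1) → ℝ :=
    Fin.cons ((x (.inr (.inr 0)) + x (.inr (.inr 1))) / √2) (fun i => x (.inl i))
  let z : Fin (n + 1 + 1) → ℝ :=
    Fin.cons ((x (.inr (.inr 0)) - x (.inr (.inr 1))) / √2) (fun i => x (.inr (.inl i)))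
  have h0 := congrFun h (.inr (.inr 0))
  have h1 := congrFun h (.inr (.inr 1))
  simp only [Matrix.mulVec, dotProduct, Fintype.sum_sum_type, gluedMatrix, Pi.smul_apply,
    smul_eq_mul, zero_mul, Finset.sum_const_zero, add_zero, sign, if_true, Fin.isValue,
    one_ne_zero, if_false, one_mul, neg_mul, Finset.sum_neg_distrib, div_mul_eq_mul_div,
    ← Finset.sum_div] at h0 h1
  have hk0 : ∀ N, kacMatrix N 0 0 = 0 := fun N =>
    not_not.1 (mt kacMatrix_ne_zero_iff.1 (by simp))
  have hy : kacMatrix (m + 1) *ᵥ y = μ • y := by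
    ext i
    refine Fin.cases ?_ (fun i => ?_) i
    · simp only [Matrix.mulVec, dotProduct, Fin.sum_univ_succ (n := m + 1), y, Fin.cons_zero,
        Fin.cons_succ, Pi.smul_apply, smul_eq_mul, hk0, zero_mul, zero_add]
      field_simp at h0 h1 ⊢
      linear_combination (√2 / 2) * (h0 + h1) +
        (μ * (x (.inr (.inr 0)) + x (.inr (.inr 1))) / 2) * hs
    · have h3 := congrFun h (.inl i)
      simp only [Matrix.mulVec, dotProduct, Fintype.sum_sum_type, gluedMatrix, Pi.smul_apply,
        smul_eq_mul, zero_mul, Finset.sum_const_zero, zero_add, Fin.sum_univ_two] at h3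
      simp only [Matrix.mulVec, dotProduct, Fin.sum_univ_succ (n := m + 1), y, Fin.cons_zero,
        Fin.cons_succ, Pi.smul_apply, smul_eq_mul]
      rw [← h3]; ring
  have hz : kacMatrix (n + 1) *ᵥ z = μ • z := by
    ext i
    refine Fin.cases ?_ (fun i => ?_) i
    · simp only [Matrix.mulVec, dotProduct, Fin.sum_univ_succ (n := n + 1), z, Fin.cons_zero,
        Fin.cons_succ, Pi.smul_apply, smul_eq_mul, hk0, zero_mul, zero_add]
      field_simp at h0 h1 ⊢
      linear_combination (√2 / 2) * (h0 - h1) +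
        (μ * (x (.inr (.inr 0)) - x (.inr (.inr 1))) / 2) * hs
    · have h3 := congrFun h (.inr (.inl i))
      simp only [Matrix.mulVec, dotProduct, Fintype.sum_sum_type, gluedMatrix, Pi.smul_apply,
        smul_eq_mul, zero_mul, Finset.sum_const_zero, zero_add, Fin.sum_univ_two, sign, if_true,
        Fin.isValue, one_ne_zero, if_false] at h3
      simp only [Matrix.mulVec, dotProduct, Fin.sum_univ_succ (n := n + 1), z, Fin.cons_zero,
        Fin.cons_succ, Pi.smul_apply, smul_eq_mul]
      rw [← h3]; ring
  by_cases hy0 : y = 0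
  · refine Or.inr (kacMatrix_eigenvalue (fun hz0 => hx ?_) hz)
    have ey := congrFun hy0 0
    have ez := congrFun hz0 0
    simp only [y, z, Fin.cons_zero, Pi.zero_apply, div_eq_zero_iff, h2, or_false] at ey ez
    funext v
    rcases v with i | i | k
    · simpa [y] using congrFun hy0 i.succ
    · simpa [z] using congrFun hz0 i.succ
    · fin_cases k
      · show x (.inr (.inr 0)) = 0
        linarith
      · show x (.inr (.inr 1)) = 0
        linarith
  · exact Or.inl (kacMatrix_eigenvalue hy0 hy)

theorem qMatrix_gluedMatrix_le {m n : ℕ} (hmn : m % 2 = n % 2) :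
    qMatrix (gluedMatrix m n) ≤ max m n + 2 := by
  obtain ⟨M, hM⟩ : ∃ M, M = max m n + 1 := ⟨_, rfl⟩
  -- `N - 2k = M - 2(k + (M - N) / 2)`, where `M - N` is even
  have key : ∀ N k : ℕ, k ≤ N → N ≤ M → N % 2 = M % 2 →
      ((N : ℝ) - 2 * k) ∈ (Finset.range (M + 1)).image (fun k : ℕ => (M : ℝ) - 2 * k) := by
    intro N k hk hN hp
    refine Finset.mem_image.2 ⟨k + (M - N) / 2, Finset.mem_range.2 (by omega), ?_⟩
    have h1 : M = N + 2 * ((M - N) / 2) := by omega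
    have h2 : (M : ℝ) = N + 2 * ((M - N) / 2 : ℕ) := by exact_mod_cast h1
    rw [Nat.cast_add]
    linarith
  have hsub : {μ : ℝ | Module.End.HasEigenvalue (Matrix.toLin' (gluedMatrix m n)) μ} ⊆
      ((Finset.range (M + 1)).image (fun k : ℕ => (M : ℝ) - 2 * k) : Finset ℝ) := by
    intro μ hμ
    obtain ⟨x, hx⟩ := Module.End.HasEigenvalue.exists_hasEigenvector hμ
    have h := hx.apply_eq_smul
    rw [Matrix.toLin'_apply] at h
    rcases gluedMatrix_eigenvalue hx.2 h with ⟨k, hk, rfl⟩ | ⟨k, hk, rfl⟩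
    · exact key (m + 1) k hk (by omega) (by omega)
    · exact key (n + 1) k hk (by omega) (by omega)
  calc qMatrix (gluedMatrix m n)
      ≤ ((Finset.range (M + 1)).image (fun k : ℕ => (M : ℝ) - 2 * k)).card := by
        rw [← Set.ncard_coe_finset]
        exact Set.ncard_le_ncard hsub (Finset.finite_toSet _)
    _ ≤ (Finset.range (M + 1)).card := Finset.card_image_le
    _ = max m n + 2 := by rw [Finset.card_range, hM]

end DistinctEigenvalues

theorem lemma6p5 (m n : ℕ) (hmn : m % 2 = n % 2) :
    DistinctEigenvalues.qGraph (DistinctEigenvalues.SGraph m n) = max m n + 2 := by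
  open DistinctEigenvalues in
  have hleast := qGraph_isLeast (SGraph m n)
  refine le_antisymm ?_ ?_
  · exact (hleast.2 ⟨_, gluedMatrix_mem m n, rfl⟩).trans (qMatrix_gluedMatrix_le hmn)
  · obtain ⟨A, hA, hq⟩ := hleast.1
    rw [← hq]
    have h1 := left_le_qMatrix hA
    have h2 := right_le_qMatrix hA
    omega
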